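/- Let $q$ be a prime power, let $\mathbb F_q$ be the field with $q$ elements and let $n$ be a positive integer. The functional graph of an $\mathbb F_q$-linear map $T:\mathbb F_q^n\to\mathbb F_q^n$ is the directed graph with vertex set $\mathbb F_q^n$ and edges $v\to T(v)$ for $v\in\mathbb F_q^n$. Let $A_q(n)$ be the number of pairwise non-isomorphic directed graphs that arise in this way. Let $\mathcal P_n$ be the set of all nonzero vectors $\lambda=(\lambda_1,\ldots,\lambda_n)$ of nonnegative integers with $\sum_{i=1}^n i\,\lambda_i\le n$. For $i\ge 1$ let $\sigma_i$ be the number of positive divisors of $q^i-1$, and let $\sigma_i^*$ be the number of positive integers $e$ such that $i=\min\{j>0 : q^j\equiv 1\pmod e\}$. Then $$\sum_{\lambda\in\mathcal P_n}\prod_{i=1}^n\binom{\sigma_i^*+\lambda_i-1}{\lambda_i}\;\le\; A_q(n)\;\le\; 2^{4\sqrt n}\cdot\sum_{\lambda\in\mathcal P_n}\prod_{i=1}^n\binom{\sigma_i+\lambda_i-1}{\lambda_i}.$$ -/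

import Mathlib

/-- The functional graph of a map `f : V → V`: the directed graph on `V` (loops allowed)
whose edges are exactly `v → f v`. -/
def functionalGraph {V : Type*} (f : V → V) : Digraph V where
  Adj v w := f v = w

/-- Isomorphism of directed graphs: a bijection of the vertex sets that preserves and reflects
the edge relation. -/
def Digraph.IsIsomorphic {V W : Type*} (G : Digraph V) (H : Digraph W) : Prop :=
  Nonempty (G.Adj ≃r H.Adj)

/-- Two linear endomorphisms of `F ^ n` are identified when their functional graphs are
isomorphic. -/
def functionalGraphSetoid (F : Type*) [Field F] (n : ℕ) :
    Setoid ((Fin n → F) →ₗ[F] (Fin n → F)) where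
  r S T := (functionalGraph S).IsIsomorphic (functionalGraph T)
  iseqv :=
    { refl := fun _ => ⟨RelIso.refl _⟩
      symm := fun ⟨e⟩ => ⟨e.symm⟩
      trans := fun ⟨e⟩ ⟨e'⟩ => ⟨e.trans e'⟩ }

/-- The number of pairwise non-isomorphic functional graphs of linear maps `F ^ n → F ^ n`. -/
noncomputable def numFunctionalGraphs (F : Type*) [Field F] (n : ℕ) : ℕ :=
  Nat.card (Quotient (functionalGraphSetoid F n))

/-- The number of positive divisors of `q ^ i - 1`. -/
def numDivisors (q i : ℕ) : ℕ := (q ^ i - 1).divisors.card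

/-- The number of positive integers `e` such that `i` is the order of `q` modulo `e`, that is,
`i = min {j > 0 | q ^ j ≡ 1 (mod e)}`. -/
noncomputable def numModuliOfOrder (q i : ℕ) : ℕ :=
  Set.ncard {e : ℕ | 0 < e ∧ IsLeast {j : ℕ | 0 < j ∧ q ^ j ≡ 1 [MOD e]} i}

/-- The nonzero vectors `(lam_1, …, lam_n)` of natural numbers with `∑ i * lam_i ≤ n`. The entry
`lam_i` is `lam k` with `i = k + 1`. The bound on the entries only serves to make the
collection a `Finset`; it follows from the inequality, see `mem_boundedWeightVectors`. -/
def boundedWeightVectors (n : ℕ) : Finset (Fin n → ℕ) :=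
  (Fintype.piFinset fun _ : Fin n => Finset.range (n + 1)).filter
    fun lam => lam ≠ 0 ∧ ∑ k : Fin n, lam k * ((k : ℕ) + 1) ≤ n

theorem mem_boundedWeightVectors {n : ℕ} {lam : Fin n → ℕ} :
    lam ∈ boundedWeightVectors n ↔ lam ≠ 0 ∧ ∑ k : Fin n, lam k * ((k : ℕ) + 1) ≤ n := by
  unfold boundedWeightVectors
  rw [Finset.mem_filter, and_iff_right_iff_imp]
  rintro ⟨-, h⟩
  rw [Fintype.mem_piFinset]
  intro k
  have h1 := Finset.single_le_sum (f := fun k : Fin n => lam k * ((k : ℕ) + 1))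
    (fun _ _ => Nat.zero_le _) (Finset.mem_univ k)
  have h2 : lam k ≤ lam k * ((k : ℕ) + 1) := Nat.le_mul_of_pos_right _ (Nat.succ_pos _)
  rw [Finset.mem_range]
  exact Nat.lt_succ_of_le (h2.trans (h1.trans h))

open Polynomial

universe u

/-! Up to conjugacy, `T` acts as multiplication by `X` on a direct sum of blocks `F[X]/(p^k)`, `p`
irreducible. The graph of a block depends only on its dimension `d = k * deg p` and on the order `o`
of the root of `p`, with `o = 0` encoding the nilpotent case `p ~ X`. For `o ≠ 0` the block is a
permutation, hence determined up to conjugacy by the numbers of fixed points of its iterates. The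
`m`-th iterate fixes the kernel of `X^m - 1`, whose size depends on `deg p`, `k` and the exponent of
`p` in `X^m - 1`. That exponent is the `c`-part of `m` (`c` the characteristic) if `o ∣ m` and zero
otherwise, while `deg p` is the order of `q` modulo `o`.

Upper bound: the graph is determined by the number of blocks for each pair `(d, o)`. If `λ_i`
invertible blocks have dimension `i`, their orders form a multiset of divisors of `q^i - 1`, and the
nilpotent blocks form a partition of `n - ∑ i λ_i`. The number of such partitions is at most
`2^(4√n) / 2`; the spare factor 2 absorbs the term `λ = 0`.

Lower bound: if `q` has order `i` modulo `e`, multiplication by an element of order `e` on the field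
with `q^i` elements is a block. Sums of such blocks, padded by a zero map, are told apart by the
fixed points of their iterates through uniqueness in Möbius inversion, as `e` determines `i`. -/

/-! ### Permutations are determined by the fixed points of their iterates -/

theorem Nat.eq_of_sum_divisors_eq {f g : ℕ → ℕ}
    (h : ∀ m, 0 < m → ∑ d ∈ m.divisors, f d = ∑ d ∈ m.divisors, g d) :
    ∀ m, 0 < m → f m = g m := by
  intro m
  induction m using Nat.strong_induction_on with
  | _ m ih =>
    intro hm
    have h1 := h m hm
    rw [← Nat.cons_self_properDivisors hm.ne', Finset.sum_cons, Finset.sum_cons] at h1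
    have h2 : ∑ d ∈ m.properDivisors, f d = ∑ d ∈ m.properDivisors, g d :=
      Finset.sum_congr rfl fun d hd =>
        ih d (Nat.mem_properDivisors.1 hd).2 (Nat.pos_of_mem_properDivisors hd)
    omega

theorem Fintype.card_iterate_fixed {X : Type*} [Fintype X] [DecidableEq X] (f : X → X) {m : ℕ}
    (hm : 0 < m) :
    (Finset.univ.filter fun x => f^[m] x = x).card =
      ∑ d ∈ m.divisors, (Finset.univ.filter fun x => Function.minimalPeriod f x = d).card := by
  have : ∀ x ∈ Finset.univ.filter (fun x => f^[m] x = x),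
      Function.minimalPeriod f x ∈ m.divisors := by
    intro x hx
    rw [Nat.mem_divisors]
    exact ⟨Function.IsPeriodicPt.minimalPeriod_dvd (Finset.mem_filter.1 hx).2, hm.ne'⟩
  rw [Finset.card_eq_sum_card_fiberwise this]
  refine Finset.sum_congr rfl fun d hd => ?_
  congr 1
  ext x
  simp only [Finset.mem_filter, Finset.mem_univ, true_and, and_iff_right_iff_imp]
  rintro rfl
  exact Function.isPeriodicPt_iff_minimalPeriod_dvd.2 (Nat.dvd_of_mem_divisors hd)

theorem Equiv.Perm.card_support_cycleOf_eq_minimalPeriod {X : Type*} [Fintype X] [DecidableEq X]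
    (σ : Equiv.Perm X) {x : X} (hx : σ x ≠ x) :
    (σ.cycleOf x).support.card = Function.minimalPeriod σ x := by
  have key : ∀ n, (⇑σ)^[n] x = x ↔ (σ.cycleOf x).support.card ∣ n := fun n => by
    rw [iterate_eq_pow]
    exact (isCycleOn_support_cycleOf σ x).pow_apply_eq
      (by rw [mem_support, cycleOf_apply_self]; exact hx)
  exact Nat.dvd_antisymm ((key _).1 (Function.iterate_minimalPeriod))
    (Function.IsPeriodicPt.minimalPeriod_dvd ((key _).2 dvd_rfl))

theorem Equiv.Perm.card_minimalPeriod_eq {X : Type*} [Fintype X] [DecidableEq X]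
    (σ : Equiv.Perm X) {c : ℕ} (hc : 2 ≤ c) :
    (Finset.univ.filter fun x => Function.minimalPeriod σ x = c).card =
      c * σ.cycleType.count c := by
  have hmem : ∀ x ∈ Finset.univ.filter (fun x => Function.minimalPeriod σ x = c),
      σ.cycleOf x ∈ σ.cycleFactorsFinset.filter fun τ => τ.support.card = c := by
    intro x hx
    have hx' := (Finset.mem_filter.1 hx).2
    have hne : σ x ≠ x := by
      intro h
      have : Function.minimalPeriod σ x ≤ 1 :=
        Function.IsPeriodicPt.minimalPeriod_le one_pos h
      omega
    rw [Finset.mem_filter]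
    exact ⟨cycleOf_mem_cycleFactorsFinset_iff.2 (mem_support.2 hne),
      (card_support_cycleOf_eq_minimalPeriod σ hne).trans hx'⟩
  have hcount : σ.cycleType.count c =
      (σ.cycleFactorsFinset.filter fun τ => τ.support.card = c).card := by
    rw [cycleType_def, Multiset.count_map, Finset.card_def, Finset.filter_val]
    simp only [Function.comp_apply, eq_comm]
  rw [Finset.card_eq_sum_card_fiberwise hmem, hcount, mul_comm]
  refine Finset.sum_const_nat (m := c) fun τ hτ => ?_
  obtain ⟨hτ, hτc⟩ := Finset.mem_filter.1 hτ
  rw [← hτc]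
  congr 1
  ext x
  rw [Finset.mem_filter, Finset.mem_filter, ← eq_cycleOf_of_mem_cycleFactorsFinset_iff σ τ hτ,
    eq_comm (a := τ)]
  simp only [Finset.mem_univ, true_and, and_iff_right_iff_imp]
  intro hx
  have hmem : x ∈ τ.support := (eq_cycleOf_of_mem_cycleFactorsFinset_iff σ τ hτ x).1 hx.symm
  have hne := mem_support.1 (mem_cycleFactorsFinset_support_le hτ hmem)
  rw [← card_support_cycleOf_eq_minimalPeriod σ hne, hx]

/-- Inversion over divisors turns fixed-point counts into counts of points of each minimal period,
hence into the cycle type. Cycle types omit fixed points, so lengths below 2 impose nothing. -/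
theorem Equiv.Perm.isConj_of_card_fixed_eq {X : Type*} [Fintype X] [DecidableEq X]
    (σ τ : Equiv.Perm X)
    (h : ∀ m, 0 < m → Nat.card {x // σ^[m] x = x} = Nat.card {x // τ^[m] x = x}) :
    IsConj σ τ := by
  have key := Nat.eq_of_sum_divisors_eq
    (f := fun d => (Finset.univ.filter fun x => Function.minimalPeriod σ x = d).card)
    (g := fun d => (Finset.univ.filter fun x => Function.minimalPeriod τ x = d).card)
    (fun m hm => by
      have := h m hm
      rw [Nat.card_eq_fintype_card, Nat.card_eq_fintype_card, Fintype.card_subtype,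
        Fintype.card_subtype] at this
      simpa only [Fintype.card_iterate_fixed _ hm] using this)
  rw [isConj_iff_cycleType_eq]
  ext c
  by_cases hc : 2 ≤ c
  · have := key c (by omega)
    simp only [card_minimalPeriod_eq _ hc] at this
    exact Nat.eq_of_mul_eq_mul_left (by omega) this
  · rw [Multiset.count_eq_zero_of_notMem, Multiset.count_eq_zero_of_notMem] <;>
      exact fun h => hc (two_le_of_mem_cycleType h)

/-- Two bijective self-maps of finite types with equally many fixed points of all iterates are
conjugate. -/
theorem Function.exists_semiconj_of_card_fixed_eq {X Y : Type*} [Finite X] [Finite Y]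
    {f : X → X} {g : Y → Y} (hf : f.Bijective) (hg : g.Bijective)
    (h : ∀ m, 0 < m → Nat.card {x // f^[m] x = x} = Nat.card {y // g^[m] y = y}) :
    ∃ e : X ≃ Y, Function.Semiconj e f g := by
  classical
  have := Fintype.ofFinite X
  have := Fintype.ofFinite Y
  let σ : Equiv.Perm X := Equiv.ofBijective f hf
  let τ : Equiv.Perm Y := Equiv.ofBijective g hg
  have hcard : Nat.card X = Nat.card Y := by
    -- At this exponent both iterates are the identity, so the fixed-point counts are the full
    -- cardinalities.
    have h1 := h (orderOf σ * orderOf τ) (Nat.mul_pos (orderOf_pos σ) (orderOf_pos τ))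
    have h2 : ∀ x, f^[orderOf σ * orderOf τ] x = x := fun x => by
      change (⇑σ)^[_] x = x
      rw [Equiv.Perm.iterate_eq_pow, pow_mul, pow_orderOf_eq_one, one_pow, Equiv.Perm.one_apply]
    have h3 : ∀ x, g^[orderOf σ * orderOf τ] x = x := fun x => by
      change (⇑τ)^[_] x = x
      rw [Equiv.Perm.iterate_eq_pow, mul_comm, pow_mul, pow_orderOf_eq_one, one_pow,
        Equiv.Perm.one_apply]
    simpa only [h2, h3, Nat.card_congr (Equiv.subtypeUnivEquiv fun _ => trivial)] using h1
  obtain ⟨a⟩ : Nonempty (X ≃ Y) := Finite.card_eq.1 hcard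
  have hs : ∀ m y, (⇑((a.symm.trans σ).trans a))^[m] y = a (f^[m] (a.symm y)) := by
    intro m
    induction m with
    | zero => simp
    | succ m ih => intro y; rw [Function.iterate_succ_apply', ih, Function.iterate_succ_apply']; simp [σ]
  have hconj : IsConj ((a.symm.trans σ).trans a) τ := by
    refine Equiv.Perm.isConj_of_card_fixed_eq _ _ fun m hm => ?_
    refine Eq.trans (Nat.card_congr ?_) (h m hm)
    exact (a.subtypeEquiv fun x => by rw [hs]; simp).symm
  obtain ⟨c, hc⟩ := isConj_iff.1 hconj
  refine ⟨a.trans c, fun x => ?_⟩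
  have := congrArg (fun p : Equiv.Perm Y => p (c (a x))) hc
  simpa [σ, τ] using this

/-! ### Multiplication by `X` on `F[X]/(p^k)` -/

theorem AdjoinRoot.natCard {F : Type*} [Field F] [Finite F] {g : F[X]} (hg : g ≠ 0) :
    Nat.card (AdjoinRoot g) = Nat.card F ^ g.natDegree := by
  have : Module.Finite F (AdjoinRoot g) := (AdjoinRoot.powerBasis hg).finite
  rw [Module.natCard_eq_pow_finrank (K := F)]
  congr 1
  exact finrank_quotient_span_eq_natDegree (f := g)

theorem AdjoinRoot.finite_of_ne_zero {F : Type*} [Field F] [Finite F] {g : F[X]} (hg : g ≠ 0) :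
    Finite (AdjoinRoot g) :=
  have : Module.Finite F (AdjoinRoot g) := (AdjoinRoot.powerBasis hg).finite
  Module.finite_of_finite F

/-- The annihilator of `p ^ w * u` in `F[X] / (p ^ k)`, for `u` prime to `p`. -/
theorem AdjoinRoot.natCard_annihilator {F : Type*} [Field F] [Finite F] {p u : F[X]}
    (hp : Irreducible p) (hu : IsCoprime p u) (w k : ℕ) :
    Nat.card {v : AdjoinRoot (p ^ k) // AdjoinRoot.mk (p ^ k) (p ^ w * u) * v = 0} =
      Nat.card F ^ (p.natDegree * min w k) := by
  have hjk : min w k ≤ k := min_le_right w k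
  set j := min w k with hj
  let _ : Module F[X] (AdjoinRoot (p ^ k)) := Submodule.Quotient.module (Ideal.span {p ^ k})
  -- Multiplication by `p^(k-j)` has the annihilator as range and `(p^j)` as kernel, so the
  -- annihilator has the size of `F[X]/(p^j)`.
  let φ : F[X] →ₗ[F[X]] AdjoinRoot (p ^ k) :=
    (Ideal.span {p ^ k}).mkQ.comp (LinearMap.mulLeft F[X] (p ^ (k - j)))
  have hφ : ∀ f, φ f = AdjoinRoot.mk (p ^ k) (p ^ (k - j) * f) := fun f => rfl
  have hker : LinearMap.ker φ = Ideal.span {p ^ j} := by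
    ext f
    rw [LinearMap.mem_ker, hφ, AdjoinRoot.mk_eq_zero, Ideal.mem_span_singleton]
    conv_lhs => rw [show p ^ k = p ^ (k - j) * p ^ j by rw [← pow_add, Nat.sub_add_cancel hjk]]
    exact mul_dvd_mul_iff_left (pow_ne_zero _ hp.ne_zero)
  have hrange : ∀ v, AdjoinRoot.mk (p ^ k) (p ^ w * u) * v = 0 ↔ v ∈ LinearMap.range φ := by
    intro v
    obtain ⟨f, rfl⟩ := AdjoinRoot.mk_surjective v
    rw [← map_mul, AdjoinRoot.mk_eq_zero]
    have h1 : AdjoinRoot.mk (p ^ k) f ∈ LinearMap.range φ ↔ p ^ (k - j) ∣ f := by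
      constructor
      · rintro ⟨g, hg⟩
        rw [hφ, AdjoinRoot.mk_eq_mk] at hg
        have h2 : p ^ (k - j) ∣ p ^ (k - j) * g - f := (pow_dvd_pow p (Nat.sub_le k j)).trans hg
        exact (dvd_sub_right (dvd_mul_right _ _)).1 h2
      · rintro ⟨g, rfl⟩
        exact ⟨g, rfl⟩
    rw [h1]
    rcases le_total k w with hw | hw
    · rw [min_eq_right hw] at hj
      simp only [hj, Nat.sub_self, pow_zero, one_dvd, iff_true]
      exact Dvd.dvd.mul_right (Dvd.dvd.mul_right (pow_dvd_pow p hw) _) _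
    · rw [min_eq_left hw] at hj
      rw [hj, mul_assoc]
      conv_lhs => rw [show p ^ k = p ^ w * p ^ (k - w) by rw [← pow_add, Nat.add_sub_cancel' hw]]
      rw [mul_dvd_mul_iff_left (pow_ne_zero _ hp.ne_zero)]
      exact ⟨(hu.pow_left).dvd_of_dvd_mul_left, fun h => Dvd.dvd.mul_left h _⟩
  rw [Nat.card_congr (Equiv.subtypeEquivRight hrange)]
  change Nat.card (LinearMap.range φ) = _
  rw [← Nat.card_congr φ.quotKerEquivRange.toEquiv, hker, mul_comm, ← natDegree_pow]
  exact AdjoinRoot.natCard (pow_ne_zero _ hp.ne_zero)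

/-- For an irreducible polynomial `p` over a finite field, the exponent of `p` in `X ^ m - 1`
depends only on the order of `X` modulo `p`. -/
theorem Polynomial.exists_X_pow_sub_one_eq {F : Type*} [Field F] (c : ℕ) [CharP F c]
    (hc : c.Prime) {p : F[X]} (hp : Irreducible p) {m : ℕ} (hm : 0 < m) :
    ∃ u : F[X], IsCoprime p u ∧ (X ^ m - 1 : F[X]) =
      p ^ (if orderOf (AdjoinRoot.root p) ∣ m then ordProj[c] m else 0) * u := by
  have : Fact c.Prime := ⟨hc⟩
  have hdvd : ∀ l, p ∣ X ^ l - 1 ↔ orderOf (AdjoinRoot.root p) ∣ l := by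
    intro l
    rw [orderOf_dvd_iff_pow_eq_one, ← AdjoinRoot.mk_eq_zero, map_sub, map_pow, map_one,
      AdjoinRoot.mk_X, sub_eq_zero]
  have hfact : (X ^ m - 1 : F[X]) = (X ^ (ordCompl[c] m) - 1) ^ (ordProj[c] m) := by
    rw [sub_pow_char_pow, ← pow_mul, one_pow, mul_comm, Nat.ordProj_mul_ordCompl_eq_self]
  split_ifs with h
  · have h1 : p ∣ X ^ (ordCompl[c] m) - 1 := by
      have := (hdvd m).2 h
      rw [hfact] at this
      exact hp.prime.dvd_of_dvd_pow this
    obtain ⟨u, hu⟩ := h1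
    refine ⟨u ^ ordProj[c] m, IsCoprime.pow_right ?_, ?_⟩
    · rw [hp.coprime_iff_not_dvd]
      rintro ⟨v, rfl⟩
      -- The prime-to-`c` part of `m` gives a separable polynomial, so `p` divides it exactly once
      -- and all multiplicity comes from the power `ordProj[c] m`.
      have hsq : Squarefree (X ^ (ordCompl[c] m) - 1 : F[X]) := by
        have := separable_X_pow_sub_C' c (ordCompl[c] m) (1 : F)
          (Nat.not_dvd_ordCompl hc hm.ne') one_ne_zero
        rw [map_one] at this
        exact this.squarefree
      exact hp.not_isUnit (hsq p ⟨v, by rw [hu, mul_assoc]⟩)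
    · rw [hfact, hu, mul_pow]
  · refine ⟨X ^ m - 1, ?_, by rw [pow_zero, one_mul]⟩
    rw [hp.coprime_iff_not_dvd, hdvd]
    exact h

/-- Multiplication by the class of `X` on `F[X] / (g)`. -/
noncomputable def AdjoinRoot.mulRoot {F : Type*} [Field F] (g : F[X]) :
    AdjoinRoot g → AdjoinRoot g :=
  fun v => AdjoinRoot.root g * v

theorem AdjoinRoot.mulRoot_iterate {F : Type*} [Field F] (g : F[X]) (m : ℕ) (v : AdjoinRoot g) :
    (AdjoinRoot.mulRoot g)^[m] v = AdjoinRoot.root g ^ m * v :=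
  mul_left_iterate_apply _ _

theorem AdjoinRoot.natCard_fixed_mulRoot {F : Type*} [Field F] [Finite F] (c : ℕ) [CharP F c]
    (hc : c.Prime) {p : F[X]} (hp : Irreducible p) (k : ℕ) {m : ℕ} (hm : 0 < m) :
    Nat.card {v // (AdjoinRoot.mulRoot (p ^ k))^[m] v = v} =
      Nat.card F ^ (p.natDegree *
        min (if orderOf (AdjoinRoot.root p) ∣ m then ordProj[c] m else 0) k) := by
  obtain ⟨u, hu, h⟩ := exists_X_pow_sub_one_eq c hc hp hm
  rw [← natCard_annihilator hp hu, ← h]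
  refine Nat.card_congr (Equiv.subtypeEquivRight fun v => ?_)
  rw [mulRoot_iterate, map_sub, map_pow, map_one, mk_X, sub_mul, one_mul, sub_eq_zero]

/-- Nonzero elements of a finite field have positive order, so the default value 0 of `orderOf`
singles out the nilpotent blocks. -/
theorem AdjoinRoot.orderOf_root_eq_zero_iff {F : Type*} [Field F] [Finite F] {p : F[X]}
    (hp : Irreducible p) : orderOf (AdjoinRoot.root p) = 0 ↔ Associated p X := by
  have : Fact (Irreducible p) := ⟨hp⟩
  have := AdjoinRoot.finite_of_ne_zero hp.ne_zero
  rw [← hp.dvd_irreducible_iff_associated irreducible_X, ← AdjoinRoot.mk_eq_zero, AdjoinRoot.mk_X]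
  constructor
  · intro h
    by_contra hne
    have h2 := orderOf_pos (Units.mk0 _ hne)
    rw [← orderOf_units, Units.val_mk0, h] at h2
    exact h2.false
  · intro h
    rw [h, orderOf_zero]

theorem AdjoinRoot.orderOf_root_dvd {F : Type*} [Field F] [Finite F] {p : F[X]}
    (hp : Irreducible p) (h0 : orderOf (AdjoinRoot.root p) ≠ 0) :
    orderOf (AdjoinRoot.root p) ∣ Nat.card F ^ p.natDegree - 1 := by
  have : Fact (Irreducible p) := ⟨hp⟩
  have := AdjoinRoot.finite_of_ne_zero hp.ne_zero
  have := Fintype.ofFinite (AdjoinRoot p)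
  have hne : AdjoinRoot.root p ≠ 0 := fun h => h0 (by rw [h, orderOf_zero])
  rw [orderOf_dvd_iff_pow_eq_one, ← AdjoinRoot.natCard hp.ne_zero, Nat.card_eq_fintype_card]
  exact FiniteField.pow_card_sub_one_eq_one _ hne

/-- The degree of an irreducible polynomial over a finite field is determined by the order of
its roots. -/
theorem AdjoinRoot.natDegree_eq_of_orderOf_eq {F : Type*} [Field F] [Finite F] {p p' : F[X]}
    (hp : Irreducible p) (hp' : Irreducible p')
    (h0 : orderOf (AdjoinRoot.root p) ≠ 0)
    (h : orderOf (AdjoinRoot.root p) = orderOf (AdjoinRoot.root p')) :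
    p.natDegree = p'.natDegree := by
  obtain ⟨c, hc⟩ := CharP.exists F
  have := Fintype.ofFinite F
  obtain ⟨n, hcp, hn⟩ := FiniteField.card F c
  have hcop : Nat.Coprime c (orderOf (AdjoinRoot.root p)) := by
    have h1 := orderOf_root_dvd hp h0
    rw [Nat.card_eq_fintype_card, hn] at h1
    have hd : 0 < p.natDegree := hp.natDegree_pos
    refine Nat.Coprime.coprime_dvd_right h1 ?_
    have h2 : 1 ≤ (c ^ (n : ℕ)) ^ p.natDegree := Nat.one_le_pow _ _ (pow_pos hcp.pos _)
    refine Nat.Coprime.coprime_dvd_left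
      ((dvd_pow_self _ n.ne_zero).trans (dvd_pow_self _ hd.ne')) ?_
    exact (Nat.coprime_self_sub_right h2).2 (Nat.coprime_one_right _)
  have hcyc : ∀ {r : F[X]}, Irreducible r → orderOf (AdjoinRoot.root r) ≠ 0 →
      r ∣ cyclotomic (orderOf (AdjoinRoot.root r)) F := by
    intro r hr hr0
    have : Fact (Irreducible r) := ⟨hr⟩
    have h1 := (IsPrimitiveRoot.orderOf (AdjoinRoot.root r)).isRoot_cyclotomic
      (Nat.pos_of_ne_zero hr0)
    rw [← map_cyclotomic _ (AdjoinRoot.of r), IsRoot.def, eval_map] at h1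
    rw [← AdjoinRoot.mk_eq_zero, ← AdjoinRoot.aeval_eq]
    exact h1
  have := Fact.mk hcp
  -- Every irreducible factor of the `o`-th cyclotomic polynomial, `o` prime to `c`, has as degree
  -- the order of `q` modulo `o`.
  rw [natDegree_of_dvd_cyclotomic_of_irreducible (p := c) (f := n) (hn) hcop
    (hcyc hp h0) hp, natDegree_of_dvd_cyclotomic_of_irreducible (p := c) (f := n)
    (hn) hcop (h ▸ hcyc hp' (h ▸ h0)) hp']

theorem AdjoinRoot.mulRoot_bijective {F : Type*} [Field F] [Finite F] {p : F[X]}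
    (hp : Irreducible p) (h0 : orderOf (AdjoinRoot.root p) ≠ 0) (k : ℕ) :
    Function.Bijective (AdjoinRoot.mulRoot (p ^ k)) := by
  have := AdjoinRoot.finite_of_ne_zero (pow_ne_zero k hp.ne_zero)
  refine Function.Injective.bijective_of_finite fun v w h => ?_
  obtain ⟨f, rfl⟩ := AdjoinRoot.mk_surjective v
  obtain ⟨g, rfl⟩ := AdjoinRoot.mk_surjective w
  rw [mulRoot, mulRoot, ← mk_X, ← map_mul, ← map_mul, mk_eq_mk, ← mul_sub] at h
  rw [mk_eq_mk]
  refine IsCoprime.dvd_of_dvd_mul_left (IsCoprime.pow_left ?_) h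
  rw [hp.coprime_iff_not_dvd, hp.dvd_irreducible_iff_associated irreducible_X,
    ← orderOf_root_eq_zero_iff hp]
  exact h0

/-- The functional graph of multiplication by `X` on `F[X] / (p ^ k)` is determined by the
dimension and the order of the roots of `p`. -/
theorem AdjoinRoot.exists_semiconj_mulRoot {F : Type*} [Field F] [Finite F] {p p' : F[X]}
    (hp : Irreducible p) (hp' : Irreducible p') {k k' : ℕ}
    (hdim : k * p.natDegree = k' * p'.natDegree)
    (hord : orderOf (AdjoinRoot.root p) = orderOf (AdjoinRoot.root p')) :
    ∃ e : AdjoinRoot (p ^ k) ≃ AdjoinRoot (p' ^ k'),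
      Function.Semiconj e (AdjoinRoot.mulRoot (p ^ k)) (AdjoinRoot.mulRoot (p' ^ k')) := by
  have hdeg : p.natDegree = p'.natDegree := by
    by_cases h0 : orderOf (AdjoinRoot.root p) = 0
    · exact natDegree_eq_of_degree_eq (degree_eq_degree_of_associated
        (((orderOf_root_eq_zero_iff hp).1 h0).trans
          ((orderOf_root_eq_zero_iff hp').1 (hord ▸ h0)).symm))
    · exact natDegree_eq_of_orderOf_eq hp hp' h0 hord
  have hk : k = k' := Nat.eq_of_mul_eq_mul_right hp.natDegree_pos (hdim.trans (by rw [hdeg]))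
  subst hk
  -- Nilpotent blocks are not permutations; there the two ideals coincide outright. Otherwise fixed
  -- points are compared.
  by_cases h0 : orderOf (AdjoinRoot.root p) = 0
  · have hass : Associated p p' := ((orderOf_root_eq_zero_iff hp).1 h0).trans
      ((orderOf_root_eq_zero_iff hp').1 (hord ▸ h0)).symm
    let e := Ideal.quotEquivOfEq (Ideal.span_singleton_eq_span_singleton.2 (hass.pow_pow (n := k)))
    refine ⟨e.toEquiv, fun v => ?_⟩
    exact map_mul e (AdjoinRoot.root _) v
  · obtain ⟨c, hc⟩ := CharP.exists F
    have := Fintype.ofFinite F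
    obtain ⟨n, hcp, hn⟩ := FiniteField.card F c
    have := AdjoinRoot.finite_of_ne_zero (pow_ne_zero k hp.ne_zero)
    have := AdjoinRoot.finite_of_ne_zero (pow_ne_zero k hp'.ne_zero)
    refine Function.exists_semiconj_of_card_fixed_eq (mulRoot_bijective hp h0 k)
      (mulRoot_bijective hp' (hord ▸ h0) k) fun m hm => ?_
    rw [natCard_fixed_mulRoot c hcp hp k hm, natCard_fixed_mulRoot c hcp hp' k hm, hord, hdeg]

/-! ### Primary decomposition and block counts -/

theorem functionalGraph_isIsomorphic_iff {V W : Type*} {f : V → V} {g : W → W} :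
    (functionalGraph f).IsIsomorphic (functionalGraph g) ↔
      ∃ e : V ≃ W, Function.Semiconj e f g := by
  constructor
  · rintro ⟨e⟩
    exact ⟨e.toEquiv, fun v => ((e.map_rel_iff (a := v) (b := f v)).2 rfl).symm⟩
  · rintro ⟨e, he⟩
    refine ⟨⟨e, fun {a b} => ?_⟩⟩
    change g (e a) = e b ↔ f a = b
    rw [← he a, e.apply_eq_iff_eq]

theorem Function.exists_semiconj_pi {ι κ : Type*} {A : ι → Type*} {B : κ → Type*}
    {f : ∀ i, A i → A i} {g : ∀ j, B j → B j} (E : ι ≃ κ)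
    (h : ∀ i, ∃ e : A i ≃ B (E i), Function.Semiconj e (f i) (g (E i))) :
    ∃ e : (∀ i, A i) ≃ (∀ j, B j),
      Function.Semiconj e (fun v i => f i (v i)) (fun w j => g j (w j)) := by
  choose e he using h
  refine ⟨Equiv.piCongr E e, fun v => funext fun j => ?_⟩
  obtain ⟨i, rfl⟩ := E.surjective j
  change Equiv.piCongr E e _ (E i) = g (E i) (Equiv.piCongr E e v (E i))
  rw [Equiv.piCongr_apply_apply, Equiv.piCongr_apply_apply]
  exact he i (v i)

/-- Every linear endomorphism is conjugate to a product of multiplications by `X` on quotients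
of `F[X]` by powers of irreducible polynomials. -/
theorem LinearMap.exists_semiconj_pi_mulRoot {F : Type u} [Field F] [Finite F] {n : ℕ}
    (T : (Fin n → F) →ₗ[F] (Fin n → F)) :
    ∃ (ι : Type u) (_ : Fintype ι) (p : ι → F[X]) (k : ι → ℕ),
      (∀ i, Irreducible (p i)) ∧ (∀ i, 0 < k i) ∧ ∑ i, k i * (p i).natDegree = n ∧
      ∃ e : (Fin n → F) ≃ ∀ i, AdjoinRoot (p i ^ k i),
        Function.Semiconj e T fun v i => AdjoinRoot.mulRoot (p i ^ k i) (v i) := by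
  classical
  obtain ⟨ι, _, p, hp, k, ⟨φ⟩⟩ := Module.equiv_directSum_of_isTorsion
    (Module.AEval.isTorsion_of_finiteDimensional F (Fin n → F) T)
  let e₀ : (Fin n → F) ≃ ∀ i, AdjoinRoot (p i ^ k i) :=
    (Module.AEval'.of T).toEquiv.trans (φ.toEquiv.trans DFinsupp.equivFunOnFintype)
  have he₀ : Function.Semiconj e₀ T fun v i => AdjoinRoot.mulRoot (p i ^ k i) (v i) := by
    intro v
    funext i
    change (φ (Module.AEval'.of T (T v))) i = _
    rw [← Module.AEval'.X_smul_of, map_smul]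
    rfl
  -- Factors with `k i = 0` are trivial rings and are dropped, so that every block has positive
  -- dimension.
  let r : (∀ i, AdjoinRoot (p i ^ k i)) ≃
      ∀ i : {i // 0 < k i}, AdjoinRoot (p i.1 ^ k i.1) :=
    (Equiv.piEquivPiSubtypeProd (fun i => 0 < k i) _).trans
      (@Equiv.prodUnique _ _ (by
        have : ∀ i : {i // ¬ 0 < k i}, Subsingleton (AdjoinRoot (p i.1 ^ k i.1)) := by
          rintro ⟨i, hi⟩
          have h0 : p i ^ k i = 1 := by rw [Nat.eq_zero_of_not_pos hi, pow_zero]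
          rw [h0]
          exact subsingleton_of_zero_eq_one
            (by rw [← map_one (AdjoinRoot.mk 1), AdjoinRoot.mk_self])
        exact ⟨⟨fun _ => 0⟩, fun _ => Subsingleton.elim _ _⟩))
  have he : Function.Semiconj (e₀.trans r) T
      fun v (i : {i // 0 < k i}) => AdjoinRoot.mulRoot (p i.1 ^ k i.1) (v i) := by
    intro v
    funext i
    exact congrFun (he₀ v) i.1
  refine ⟨{i // 0 < k i}, inferInstance, fun i => p i.1, fun i => k i.1, fun i => hp i.1,
    fun i => i.2, ?_, _, he⟩
  -- The equivalence is only one of sets, so the dimensions are read off as exponents of `q` in the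
  -- cardinalities.
  have hcard := Nat.card_congr (e₀.trans r)
  rw [Nat.card_fun, Nat.card_pi, Nat.card_fin] at hcard
  simp only [AdjoinRoot.natCard (pow_ne_zero _ (hp _).ne_zero), natDegree_pow,
    Finset.prod_pow_eq_pow_sum] at hcard
  exact (Nat.pow_right_injective Finite.one_lt_card hcard).symm

/-- The number of blocks of each dimension and root order in some primary decomposition of `T`
is given by `N`. -/
def HasBlockCounts {F : Type u} [Field F] {n : ℕ} (T : (Fin n → F) →ₗ[F] (Fin n → F))
    (N : ℕ → ℕ → ℕ) : Prop :=
  ∃ (ι : Type u) (_ : Fintype ι) (p : ι → F[X]) (k : ι → ℕ),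
    (∀ i, Irreducible (p i)) ∧
    (∀ d o, Nat.card {i // (k i * (p i).natDegree, orderOf (AdjoinRoot.root (p i))) = (d, o)} =
      N d o) ∧
    ∃ e : (Fin n → F) ≃ ∀ i, AdjoinRoot (p i ^ k i),
      Function.Semiconj e T fun v i => AdjoinRoot.mulRoot (p i ^ k i) (v i)

theorem HasBlockCounts.isIsomorphic {F : Type u} [Field F] [Finite F] {n : ℕ}
    {S T : (Fin n → F) →ₗ[F] (Fin n → F)} {N : ℕ → ℕ → ℕ}
    (hS : HasBlockCounts S N) (hT : HasBlockCounts T N) :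
    (functionalGraph S).IsIsomorphic (functionalGraph T) := by
  obtain ⟨ι, _, p, k, hp, hN, e, he⟩ := hS
  obtain ⟨κ, _, p', k', hp', hN', e', he'⟩ := hT
  have hfib : ∀ b : ℕ × ℕ,
      Nonempty ({i // (k i * (p i).natDegree, orderOf (AdjoinRoot.root (p i))) = b} ≃
        {j // (k' j * (p' j).natDegree, orderOf (AdjoinRoot.root (p' j))) = b}) :=
    fun b => Finite.card_eq.1 ((hN b.1 b.2).trans (hN' b.1 b.2).symm)
  let E : ι ≃ κ := Equiv.ofFiberEquiv fun b => (hfib b).some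
  have hE : ∀ i, (k' (E i) * (p' (E i)).natDegree, orderOf (AdjoinRoot.root (p' (E i)))) =
      (k i * (p i).natDegree, orderOf (AdjoinRoot.root (p i))) :=
    fun i => Equiv.ofFiberEquiv_map (fun b => (hfib b).some) i
  obtain ⟨a, ha⟩ := Function.exists_semiconj_pi
    (f := fun i => AdjoinRoot.mulRoot (p i ^ k i)) (g := fun j => AdjoinRoot.mulRoot (p' j ^ k' j))
    E (fun i => AdjoinRoot.exists_semiconj_mulRoot (hp i) (hp' _)
      (congrArg Prod.fst (hE i)).symm (congrArg Prod.snd (hE i)).symm)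
  refine functionalGraph_isIsomorphic_iff.2 ⟨(e.trans a).trans e'.symm, fun v => ?_⟩
  rw [Equiv.trans_apply, Equiv.symm_apply_eq, he', Equiv.trans_apply, Equiv.trans_apply,
    Equiv.apply_symm_apply, he, ha]
  rfl

/-- A nonzero order divides `q^(deg p) - 1`, which divides `q^d - 1` since `deg p ∣ d`. The last
identity sorts the `n` dimensions by block size. -/
theorem exists_hasBlockCounts {F : Type u} [Field F] [Finite F] {n : ℕ}
    (T : (Fin n → F) →ₗ[F] (Fin n → F)) :
    ∃ N : ℕ → ℕ → ℕ, HasBlockCounts T N ∧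
      (∀ d o, N d o ≠ 0 → 0 < d ∧ d ≤ n ∧ (o = 0 ∨ o ∈ (Nat.card F ^ d - 1).divisors)) ∧
      ∑ k : Fin n, (N ((k : ℕ) + 1) 0 + ∑ o ∈ (Nat.card F ^ ((k : ℕ) + 1) - 1).divisors,
        N ((k : ℕ) + 1) o) * ((k : ℕ) + 1) = n := by
  classical
  obtain ⟨ι, hι, p, k, hp, hk, hsum, h⟩ := T.exists_semiconj_pi_mulRoot
  let w : ι → ℕ := fun i => k i * (p i).natDegree
  let o : ι → ℕ := fun i => orderOf (AdjoinRoot.root (p i))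
  have hw0 : ∀ i, 0 < w i := fun i => Nat.mul_pos (hk i) (hp i).natDegree_pos
  have hwn : ∀ i, w i ≤ n := fun i =>
    hsum ▸ Finset.single_le_sum (f := w) (fun _ _ => Nat.zero_le _) (Finset.mem_univ i)
  have hpow : ∀ d, 0 < d → Nat.card F ^ d - 1 ≠ 0 := fun d hd =>
    (Nat.sub_pos_of_lt (Nat.one_lt_pow hd.ne' Finite.one_lt_card)).ne'
  have ho : ∀ i, o i = 0 ∨ o i ∈ (Nat.card F ^ w i - 1).divisors := by
    intro i
    by_cases h0 : o i = 0
    · exact Or.inl h0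
    · refine Or.inr (Nat.mem_divisors.2 ⟨?_, hpow _ (hw0 i)⟩)
      refine (AdjoinRoot.orderOf_root_dvd (hp i) h0).trans ?_
      exact Nat.pow_sub_one_dvd_pow_sub_one _ (Dvd.intro_left _ rfl)
  refine ⟨fun d e => Nat.card {i // (w i, o i) = (d, e)}, ⟨ι, hι, p, k, hp, fun _ _ => rfl, h⟩,
    fun d e hne => ?_, ?_⟩
  · obtain ⟨⟨i, hi⟩⟩ := (Nat.card_ne_zero.1 hne).1
    obtain ⟨rfl, rfl⟩ := Prod.mk.inj hi
    exact ⟨hw0 i, hwn i, ho i⟩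
  · have hcard : ∀ d e, Nat.card {i // (w i, o i) = (d, e)} =
        ((Finset.univ.filter fun i => w i = d).filter fun i => o i = e).card := by
      intro d e
      rw [Nat.card_eq_fintype_card, Fintype.card_subtype, Finset.filter_filter]
      simp only [Prod.mk.injEq]
    simp only [hcard]
    have hfib : ∀ d, 0 < d → (Finset.univ.filter fun i => w i = d).card =
        ((Finset.univ.filter fun i => w i = d).filter fun i => o i = 0).card +
        ∑ e ∈ (Nat.card F ^ d - 1).divisors,
          ((Finset.univ.filter fun i => w i = d).filter fun i => o i = e).card := by
      intro d hd
      rw [Finset.card_eq_sum_card_fiberwise (f := o)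
        (t := insert 0 (Nat.card F ^ d - 1).divisors), Finset.sum_insert]
      · simp
      · intro i hi
        have hi : w i = d := by simpa using hi
        subst hi
        simpa only [Finset.coe_insert, Set.mem_insert_iff, Finset.mem_coe] using ho i
    calc _ = ∑ d : Fin n, (Finset.univ.filter fun i => w i = (d : ℕ) + 1).card * ((d : ℕ) + 1) :=
          Finset.sum_congr rfl fun d _ => by rw [← hfib _ (Nat.succ_pos _)]
      _ = ∑ d : Fin n, ∑ i with w i = (d : ℕ) + 1, w i := by
          refine Finset.sum_congr rfl fun d _ => ?_
          rw [← smul_eq_mul, ← Finset.sum_const]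
          exact Finset.sum_congr rfl fun i hi => (Finset.mem_filter.1 hi).2.symm
      _ = ∑ i, w i := by
          rw [← Finset.sum_fiberwise (s := Finset.univ)
            (g := fun i => (⟨w i - 1, by have := hw0 i; have := hwn i; omega⟩ : Fin n)) (f := w)]
          refine Finset.sum_congr rfl fun d _ => Finset.sum_congr ?_ fun _ _ => rfl
          ext i
          have := hw0 i
          simp only [Finset.mem_filter, Finset.mem_univ, true_and, Fin.ext_iff]
          omega
      _ = n := hsum

/-! ### Upper bound: counting block data -/

theorem Finset.card_piAntidiag_nat (s : Finset ℕ) (m : ℕ) :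
    (s.piAntidiag m).card = (s.card + m - 1).choose m := by
  rw [← card_finsuppAntidiag_nat_eq_choose, finsuppAntidiag]
  simp

/-- The vectors `(a_1, …, a_n)` of natural numbers with `∑ i * a_i = m`, for `m ≤ n`. -/
def weightVectors (n m : ℕ) : Finset (Fin n → ℕ) :=
  (Fintype.piFinset fun _ : Fin n => Finset.range (n + 1)).filter
    fun a => ∑ k : Fin n, a k * ((k : ℕ) + 1) = m

theorem mem_weightVectors {n m : ℕ} (hm : m ≤ n) {a : Fin n → ℕ} :
    a ∈ weightVectors n m ↔ ∑ k : Fin n, a k * ((k : ℕ) + 1) = m := by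
  unfold weightVectors
  rw [Finset.mem_filter, and_iff_right_iff_imp]
  intro h
  rw [Fintype.mem_piFinset]
  intro k
  have h1 := Finset.single_le_sum (f := fun k : Fin n => a k * ((k : ℕ) + 1))
    (fun _ _ => Nat.zero_le _) (Finset.mem_univ k)
  have h2 : a k ≤ a k * ((k : ℕ) + 1) := Nat.le_mul_of_pos_right _ (Nat.succ_pos _)
  rw [Finset.mem_range]
  omega

/-- Families of multisets: for each `k`, the multisets on `D k` of size `lam k`. -/
def multisetFamilies {n : ℕ} (D : Fin n → Finset ℕ) (lam : Fin n → ℕ) :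
    Finset (Fin n → ℕ → ℕ) :=
  Fintype.piFinset fun k => (D k).piAntidiag (lam k)

theorem card_multisetFamilies {n : ℕ} (D : Fin n → Finset ℕ) (lam : Fin n → ℕ) :
    (multisetFamilies D lam).card = ∏ k, ((D k).card + lam k - 1).choose (lam k) := by
  simp only [multisetFamilies, Fintype.card_piFinset, Finset.card_piAntidiag_nat]

/-- Each class is injectively assigned the counts of one representative: nilpotent blocks by
dimension, and a multiset of orders for each dimension. The index 0 stands for the nilpotent maps.
-/
theorem numFunctionalGraphs_le {F : Type*} [Field F] [Finite F] (n : ℕ) :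
    numFunctionalGraphs F n ≤ ∑ lam ∈ insert 0 (boundedWeightVectors n),
      (weightVectors n (n - ∑ k, lam k * ((k : ℕ) + 1))).card *
        ∏ k : Fin n, (numDivisors (Nat.card F) ((k : ℕ) + 1) + lam k - 1).choose (lam k) := by
  classical
  let D : Fin n → Finset ℕ := fun k => (Nat.card F ^ ((k : ℕ) + 1) - 1).divisors
  let data : Finset ((Fin n → ℕ) × (Fin n → ℕ → ℕ)) :=
    (insert 0 (boundedWeightVectors n)).biUnion fun lam =>
      weightVectors n (n - ∑ k, lam k * ((k : ℕ) + 1)) ×ˢ multisetFamilies D lam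
  have hdata : data.card ≤ ∑ lam ∈ insert 0 (boundedWeightVectors n),
      (weightVectors n (n - ∑ k, lam k * ((k : ℕ) + 1))).card *
        ∏ k : Fin n, (numDivisors (Nat.card F) ((k : ℕ) + 1) + lam k - 1).choose (lam k) := by
    refine Finset.card_biUnion_le.trans_eq (Finset.sum_congr rfl fun lam _ => ?_)
    rw [Finset.card_product, card_multisetFamilies]
    rfl
  let counts : (Fin n → ℕ) × (Fin n → ℕ → ℕ) → ℕ → ℕ → ℕ := fun x d o =>
    if h : 0 < d ∧ d ≤ n then
      (if o = 0 then x.1 ⟨d - 1, by omega⟩ else x.2 ⟨d - 1, by omega⟩ o) else 0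
  have hex : ∀ T : (Fin n → F) →ₗ[F] (Fin n → F), ∃ x ∈ data, HasBlockCounts T (counts x) := by
    intro T
    obtain ⟨N, hT, hN, hsum⟩ := exists_hasBlockCounts T
    let a : Fin n → ℕ := fun k => N ((k : ℕ) + 1) 0
    -- The value at `o = 0` must vanish, since 0 is not among the divisors; those counts are kept in
    -- `a`.
    let b : Fin n → ℕ → ℕ := fun k o => if o = 0 then 0 else N ((k : ℕ) + 1) o
    let lam : Fin n → ℕ := fun k => ∑ o ∈ D k, N ((k : ℕ) + 1) o
    have hsum' : ∑ k, a k * ((k : ℕ) + 1) + ∑ k, lam k * ((k : ℕ) + 1) = n := by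
      rw [← Finset.sum_add_distrib]
      exact (Finset.sum_congr rfl fun k _ => (add_mul _ _ _).symm).trans hsum
    refine ⟨(a, b), ?_, ?_⟩
    · refine Finset.mem_biUnion.2 ⟨lam, ?_, Finset.mem_product.2 ⟨?_, ?_⟩⟩
      · rw [Finset.mem_insert, mem_boundedWeightVectors]
        by_cases h0 : lam = 0
        · exact Or.inl h0
        · exact Or.inr ⟨h0, by omega⟩
      · rw [mem_weightVectors (Nat.sub_le _ _)]
        change ∑ k, a k * ((k : ℕ) + 1) = _
        omega
      · refine Fintype.mem_piFinset.2 fun k => Finset.mem_piAntidiag.2 ⟨?_, fun o ho => ?_⟩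
        · refine Finset.sum_congr rfl fun o ho => if_neg ?_
          exact (Nat.pos_of_mem_divisors ho).ne'
        · by_cases h0 : o = 0
          · exact absurd (if_pos h0) ho
          · have h1 : N ((k : ℕ) + 1) o ≠ 0 := fun h => ho (by simp [b, h])
            exact (hN _ _ h1).2.2.resolve_left h0
    · convert hT using 1
      funext d o
      by_cases hd : 0 < d ∧ d ≤ n
      · have hd1 : d - 1 + 1 = d := Nat.sub_add_cancel hd.1
        by_cases h0 : o = 0 <;> simp [counts, a, b, hd, h0, hd1]
      · simp only [counts, dif_neg hd]
        by_contra hne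
        exact hd ⟨(hN d o (Ne.symm hne)).1, (hN d o (Ne.symm hne)).2.1⟩
  refine le_trans ?_ hdata
  choose x hx hTx using hex
  have hinj : Function.Injective fun c : Quotient (functionalGraphSetoid F n) =>
      (⟨x c.out, hx c.out⟩ : data) := by
    intro c c' h
    have h1 : x c.out = x c'.out := congrArg Subtype.val h
    have h2 : HasBlockCounts c'.out (counts (x c.out)) := h1 ▸ hTx c'.out
    rw [← c.out_eq, ← c'.out_eq]
    exact Quotient.sound ((hTx c.out).isIsomorphic h2)
  have := Nat.card_le_card_of_injective _ hinj
  rwa [Nat.card_eq_fintype_card (α := data), Fintype.card_coe] at this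

/-! ### Lower bound: semisimple maps with prescribed fixed spaces -/

theorem Function.Semiconj.natCard_fixed_iterate {X Y : Type*} {f : X → X} {g : Y → Y} {e : X ≃ Y}
    (h : Function.Semiconj e f g) (m : ℕ) :
    Nat.card {x // f^[m] x = x} = Nat.card {y // g^[m] y = y} :=
  Nat.card_congr (e.subtypeEquiv fun x => by
    rw [← (h.iterate_right m).eq, e.apply_eq_iff_eq])

/-- The pairs `(n, h)` such that some linear endomorphism of `F ^ n` has `q ^ h m` vectors fixed by
its `m`-th power for all `m > 0`. -/
def fixedDimensionMonoid (F : Type*) [Field F] [Finite F] : AddSubmonoid (ℕ × (ℕ → ℕ)) where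
  carrier := {x | ∃ T : (Fin x.1 → F) →ₗ[F] (Fin x.1 → F),
    ∀ m, 0 < m → Nat.card {v // T^[m] v = v} = Nat.card F ^ x.2 m}
  zero_mem' := ⟨0, fun m _ => by
    rw [Prod.snd_zero, Pi.zero_apply, pow_zero]
    have : Subsingleton (Fin (0 : ℕ × (ℕ → ℕ)).1 → F) := inferInstanceAs (Subsingleton (Fin 0 → F))
    exact Nat.card_eq_one_iff_unique.2
      ⟨inferInstance, ⟨0, Subsingleton.elim _ _⟩⟩⟩
  add_mem' := by
    rintro ⟨a, h⟩ ⟨b, h'⟩ ⟨S, hS⟩ ⟨T, hT⟩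
    let e : ((Fin a → F) × (Fin b → F)) ≃ₗ[F] (Fin (a + b) → F) :=
      LinearEquiv.ofFinrankEq _ _ (by simp)
    refine ⟨e.conj (S.prodMap T), fun m hm => ?_⟩
    have he : Function.Semiconj e.toEquiv (Prod.map S T) (e.conj (S.prodMap T)) := fun v => by
      change e _ = e (S.prodMap T (e.symm (e v)))
      rw [e.symm_apply_apply]
      rfl
    refine (he.natCard_fixed_iterate m).symm.trans ?_
    rw [Prod.map_iterate]
    change _ = Nat.card F ^ (h m + h' m)
    rw [pow_add, ← hS m hm, ← hT m hm, ← Nat.card_prod]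
    refine Nat.card_congr ((Equiv.subtypeEquivRight fun v => ?_).trans
      (Equiv.subtypeProdEquivProd (p := fun v => S^[m] v = v) (q := fun v => T^[m] v = v)))
    exact Prod.ext_iff

theorem mem_fixedDimensionMonoid_of_finrank {F V : Type*} [Field F] [Finite F] [AddCommGroup V]
    [Module F V] [Module.Finite F V] (T : V →ₗ[F] V) {h : ℕ → ℕ}
    (hT : ∀ m, 0 < m → Nat.card {v // T^[m] v = v} = Nat.card F ^ h m) :
    (Module.finrank F V, h) ∈ fixedDimensionMonoid F := by
  let e : V ≃ₗ[F] (Fin (Module.finrank F V) → F) := LinearEquiv.ofFinrankEq _ _ (by simp)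
  refine ⟨e.conj T, fun m hm => ?_⟩
  have he : Function.Semiconj e.toEquiv T (e.conj T) := fun v => by
    change e _ = e (T (e.symm (e v)))
    rw [e.symm_apply_apply]
  rw [← he.natCard_fixed_iterate, hT m hm]

/-- The zero map pads the dimension up to `n` without adding nonzero fixed vectors. -/
theorem zero_mem_fixedDimensionMonoid (F : Type*) [Field F] [Finite F] (n : ℕ) :
    (n, 0) ∈ fixedDimensionMonoid F := by
  refine ⟨0, fun m hm => ?_⟩
  obtain ⟨m, rfl⟩ := Nat.exists_eq_succ_of_ne_zero hm.ne'
  change _ = Nat.card F ^ 0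
  rw [pow_zero]
  refine Nat.card_eq_one_iff_unique.2 ⟨⟨fun v w => Subtype.ext ?_⟩, ⟨0, ?_⟩⟩
  · have hv := v.2
    have hw := w.2
    rw [Function.iterate_succ_apply'] at hv hw
    rw [← hv, ← hw, LinearMap.zero_apply, LinearMap.zero_apply]
  · rw [Function.iterate_succ_apply', LinearMap.zero_apply]

/-- Take multiplication by a unit `u` of order `e` on the field with `q^d` elements: `u^m v = v`
forces `v = 0` or `e ∣ m`. -/
theorem cyclic_mem_fixedDimensionMonoid (F : Type*) [Field F] [Finite F] {d e : ℕ} (hd : 0 < d)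
    (he : e ∣ Nat.card F ^ d - 1) :
    (d, fun m => if e ∣ m then d else 0) ∈ fixedDimensionMonoid F := by
  obtain ⟨c, hc⟩ := CharP.exists F
  have : Fact c.Prime := ⟨CharP.char_is_prime F c⟩
  have : NeZero d := ⟨hd.ne'⟩
  let K := FiniteField.Extension F c d
  have hK : Module.finrank F K = d := FiniteField.finrank_extension F c d
  have hKcard : Nat.card K = Nat.card F ^ d := FiniteField.natCard_extension F c d
  have : Finite K := Module.finite_of_finite F
  obtain ⟨g, hg⟩ := IsCyclic.exists_ofOrder_eq_natCard (α := Kˣ)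
  rw [Nat.card_units, hKcard] at hg
  obtain ⟨t, ht⟩ := he
  have hpos : 0 < Nat.card F ^ d - 1 := Nat.sub_pos_of_lt (Nat.one_lt_pow hd.ne' Finite.one_lt_card)
  have ht0 : t ≠ 0 := by
    rintro rfl
    omega
  have hord : orderOf (g ^ t) = e := by
    rw [orderOf_pow_of_dvd ht0 (by rw [hg, ht]; exact Dvd.intro_left _ rfl), hg, ht,
      Nat.mul_div_cancel _ (Nat.pos_of_ne_zero ht0)]
  have := mem_fixedDimensionMonoid_of_finrank (F := F) (V := K)
    (LinearMap.mulLeft F ((g ^ t : Kˣ) : K)) (h := fun m => if e ∣ m then d else 0) fun m hm => by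
      have hfix : ∀ v : K, (LinearMap.mulLeft F ((g ^ t : Kˣ) : K))^[m] v = v ↔
          e ∣ m ∨ v = 0 := by
        intro v
        have h1 : (LinearMap.mulLeft F ((g ^ t : Kˣ) : K))^[m] v = ((g ^ t) ^ m : Kˣ) * v := by
          rw [Units.val_pow_eq_pow_val (g ^ t) m]
          exact mul_left_iterate_apply _ _
        by_cases hv : v = 0
        · simp [hv]
        · rw [h1, mul_eq_right₀ hv, Units.val_eq_one, ← hord, orderOf_dvd_iff_pow_eq_one]
          simp [hv]
      simp only [hfix]
      split_ifs with h
      · simp only [h, true_or]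
        rw [← hKcard]
        exact Nat.card_congr (Equiv.subtypeUnivEquiv fun _ => trivial)
      · simp [h]
  rwa [hK] at this

/-- The moduli `e` for which `q` has order `i`. -/
noncomputable def moduliOfOrder (q i : ℕ) : Finset ℕ :=
  open Classical in (q ^ i - 1).divisors.filter fun e => IsLeast {j | 0 < j ∧ q ^ j ≡ 1 [MOD e]} i

theorem mem_moduliOfOrder {q i e : ℕ} (hq : 1 < q) (hi : 0 < i) :
    e ∈ moduliOfOrder q i ↔ 0 < e ∧ IsLeast {j | 0 < j ∧ q ^ j ≡ 1 [MOD e]} i := by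
  have h1 : 1 ≤ q ^ i := Nat.one_le_pow _ _ (by omega)
  have h2 : q ^ i - 1 ≠ 0 := (Nat.sub_pos_of_lt (Nat.one_lt_pow hi.ne' hq)).ne'
  rw [moduliOfOrder, Finset.mem_filter, Nat.mem_divisors]
  constructor
  · rintro ⟨⟨hd, h0⟩, h⟩
    exact ⟨Nat.pos_of_dvd_of_pos hd (Nat.pos_of_ne_zero h0), h⟩
  · rintro ⟨h0, h⟩
    exact ⟨⟨(Nat.modEq_iff_dvd' h1).1 h.1.2.symm, h2⟩, h⟩

theorem card_moduliOfOrder {q i : ℕ} (hq : 1 < q) (hi : 0 < i) :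
    (moduliOfOrder q i).card = numModuliOfOrder q i := by
  rw [numModuliOfOrder, ← Set.ncard_coe_finset]
  congr 1
  ext e
  exact mem_moduliOfOrder hq hi

/-- The semisimple map with `c k e` eigenvalue blocks of dimension `k + 1` and order `e`. -/
theorem exists_natCard_fixed_eq (F : Type*) [Field F] [Finite F] {n : ℕ} (D : Fin n → Finset ℕ)
    (hD : ∀ k, D k ⊆ (Nat.card F ^ ((k : ℕ) + 1) - 1).divisors) (c : Fin n → ℕ → ℕ)
    (hc : ∑ k, (∑ e ∈ D k, c k e) * ((k : ℕ) + 1) ≤ n) :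
    ∃ T : (Fin n → F) →ₗ[F] (Fin n → F), ∀ m, 0 < m →
      Nat.card {v // T^[m] v = v} =
        Nat.card F ^ ∑ k, ∑ e ∈ D k, c k e * (if e ∣ m then (k : ℕ) + 1 else 0) := by
  have h1 : ∑ k : Fin n, ∑ e ∈ D k,
      c k e • ((k : ℕ) + 1, fun m => if e ∣ m then (k : ℕ) + 1 else 0) ∈ fixedDimensionMonoid F :=
    sum_mem fun k _ => sum_mem fun e he => nsmul_mem
      (cyclic_mem_fixedDimensionMonoid F (Nat.succ_pos _) (Nat.dvd_of_mem_divisors (hD k he))) _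
  have h2 := add_mem h1
    (zero_mem_fixedDimensionMonoid F (n - ∑ k, (∑ e ∈ D k, c k e) * ((k : ℕ) + 1)))
  have h3 : (∑ k : Fin n, ∑ e ∈ D k,
      c k e • (((k : ℕ) + 1, fun m => if e ∣ m then (k : ℕ) + 1 else 0) : ℕ × (ℕ → ℕ))) +
      (n - ∑ k, (∑ e ∈ D k, c k e) * ((k : ℕ) + 1), 0) =
      (n, fun m => ∑ k, ∑ e ∈ D k, c k e * (if e ∣ m then (k : ℕ) + 1 else 0)) := by
    refine Prod.ext ?_ ?_
    · simp only [Prod.fst_add, Prod.fst_sum, Prod.smul_fst, smul_eq_mul, ← Finset.sum_mul]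
      exact Nat.add_sub_cancel' hc
    · funext m
      simp [Prod.snd_sum, Finset.sum_apply]
  rw [h3] at h2
  exact h2

theorem le_numFunctionalGraphs {F : Type*} [Field F] [Finite F] (n : ℕ) :
    ∑ lam ∈ boundedWeightVectors n, ∏ k : Fin n,
      (numModuliOfOrder (Nat.card F) ((k : ℕ) + 1) + lam k - 1).choose (lam k) ≤
      numFunctionalGraphs F n := by
  classical
  have hq : 1 < Nat.card F := Finite.one_lt_card
  let D : Fin n → Finset ℕ := fun k => moduliOfOrder (Nat.card F) ((k : ℕ) + 1)
  have hD : ∀ k, D k ⊆ (Nat.card F ^ ((k : ℕ) + 1) - 1).divisors :=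
    fun k => by
      dsimp only [D, moduliOfOrder]
      exact Finset.filter_subset _ _
  -- The order of `q` modulo `e` is unique, so `e` alone determines the block dimension.
  have hdisj : ∀ k k' e, e ∈ D k → e ∈ D k' → k = k' := fun k k' e h h' =>
    Fin.ext (Nat.succ_injective (((mem_moduliOfOrder hq (Nat.succ_pos _)).1 h).2.unique
      ((mem_moduliOfOrder hq (Nat.succ_pos _)).1 h').2))
  have hmem : ∀ {lam : Fin n → ℕ} {c}, c ∈ multisetFamilies D lam →
      ∀ k, ∑ e ∈ D k, c k e = lam k ∧ ∀ e, c k e ≠ 0 → e ∈ D k := fun h k =>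
    Finset.mem_piAntidiag.1 (Fintype.mem_piFinset.1 h k)
  let data : Finset (Fin n → ℕ → ℕ) := (boundedWeightVectors n).biUnion (multisetFamilies D)
  have hdata : ∑ lam ∈ boundedWeightVectors n, ∏ k : Fin n,
      (numModuliOfOrder (Nat.card F) ((k : ℕ) + 1) + lam k - 1).choose (lam k) = data.card := by
    rw [Finset.card_biUnion]
    · refine Finset.sum_congr rfl fun lam _ => ?_
      rw [card_multisetFamilies]
      simp only [D, card_moduliOfOrder hq (Nat.succ_pos _)]
    · intro lam _ lam' _ hne
      refine Finset.disjoint_left.2 ?_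
      intro c h h'
      exact hne (funext fun k => ((hmem h k).1.symm.trans (hmem h' k).1))
  rw [hdata]
  have hex : ∀ c : data, ∃ T : (Fin n → F) →ₗ[F] (Fin n → F), ∀ m, 0 < m →
      Nat.card {v // T^[m] v = v} =
        Nat.card F ^ ∑ k, ∑ e ∈ D k, c.1 k e * (if e ∣ m then (k : ℕ) + 1 else 0) := by
    rintro ⟨c, hc⟩
    obtain ⟨lam, hlam, hc⟩ := Finset.mem_biUnion.1 hc
    refine exists_natCard_fixed_eq F D hD c ?_
    simp only [(hmem hc _).1]
    exact (mem_boundedWeightVectors.1 hlam).2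
  choose T hT using hex
  have hinj : Function.Injective fun c => (Quotient.mk (functionalGraphSetoid F n) (T c)) := by
    rintro c c' h
    obtain ⟨e, he⟩ := functionalGraph_isIsomorphic_iff.1 (Quotient.exact h)
    -- Written as a sum over divisors of `m`, the exponent can be inverted to recover each
    -- multiplicity.
    have hsum : ∀ (c : data) m, 0 < m →
        ∑ k, ∑ e ∈ D k, c.1 k e * (if e ∣ m then (k : ℕ) + 1 else 0) =
        ∑ e ∈ m.divisors, ∑ k : Fin n, if e ∈ D k then c.1 k e * ((k : ℕ) + 1) else 0 := by
      intro c m hm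
      rw [Finset.sum_comm]
      refine Finset.sum_congr rfl fun k _ => ?_
      rw [← Finset.sum_filter]
      simp only [mul_ite, mul_zero]
      rw [← Finset.sum_filter]
      refine Finset.sum_congr ?_ fun _ _ => rfl
      ext e
      simp [hm.ne', and_comm]
    have key := Nat.eq_of_sum_divisors_eq
      (f := fun e => ∑ k : Fin n, if e ∈ D k then c.1 k e * ((k : ℕ) + 1) else 0)
      (g := fun e => ∑ k : Fin n, if e ∈ D k then c'.1 k e * ((k : ℕ) + 1) else 0) fun m hm => by
      rw [← hsum c m hm, ← hsum c' m hm]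
      refine Nat.pow_right_injective (Finite.one_lt_card (α := F)) ?_
      change Nat.card F ^ _ = Nat.card F ^ _
      rw [← hT c m hm, ← hT c' m hm]
      exact he.natCard_fixed_iterate m
    refine Subtype.ext (funext fun k => funext fun e => ?_)
    by_cases hek : e ∈ D k
    · have h1 := key e ((mem_moduliOfOrder hq (Nat.succ_pos _)).1 hek).1
      have h2 : ∀ c : data, (∑ k : Fin n, if e ∈ D k then c.1 k e * ((k : ℕ) + 1) else 0) =
          c.1 k e * ((k : ℕ) + 1) := by
        intro c
        rw [Finset.sum_eq_single k, if_pos hek]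
        · exact fun k' _ hne => if_neg fun h => hne (hdisj _ _ e h hek)
        · simp
      simp only [h2] at h1
      exact Nat.eq_of_mul_eq_mul_right (Nat.succ_pos _) h1
    · have h0 : ∀ c : data, c.1 k e = 0 := by
        rintro ⟨c, hc⟩
        obtain ⟨lam, -, hc⟩ := Finset.mem_biUnion.1 hc
        exact by_contra fun hne => hek ((hmem hc k).2 e hne)
      rw [h0, h0]
  have : Finite ((Fin n → F) →ₗ[F] (Fin n → F)) := Module.finite_of_finite F
  have := Finite.of_surjective _ (Quotient.mk_surjective (s := functionalGraphSetoid F n))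
  have := Nat.card_le_card_of_injective _ hinj
  rwa [Nat.card_eq_fintype_card (α := data), Fintype.card_coe] at this

/-! ### Bounding the number of partitions -/

/-- Weight vectors inject into partitions of `m`, onto which the compositions of `m` surject. -/
theorem card_weightVectors_le_two_pow {n m : ℕ} (hm : m ≤ n) :
    (weightVectors n m).card ≤ 2 ^ (m - 1) := by
  classical
  rw [← composition_card]
  refine le_trans ?_ (Fintype.card_le_of_surjective _ (Nat.Partition.ofComposition_surj (n := m)))
  let parts : (Fin n → ℕ) → Multiset ℕ := fun a => ∑ k, Multiset.replicate (a k) ((k : ℕ) + 1)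
  have hcount : ∀ a (k : Fin n), (parts a).count ((k : ℕ) + 1) = a k := by
    intro a k
    simp [parts, Multiset.count_sum', Multiset.count_replicate, Fin.val_inj]
  have hsum : ∀ a, (parts a).sum = ∑ k, a k * ((k : ℕ) + 1) := fun a => by
    have := map_sum (Multiset.sumAddMonoidHom (M := ℕ))
      (fun k : Fin n => Multiset.replicate (a k) ((k : ℕ) + 1)) Finset.univ
    refine this.trans (Finset.sum_congr rfl fun k _ => ?_)
    exact Multiset.sum_replicate _ _
  rw [← Finset.card_univ]
  let P : weightVectors n m → m.Partition := fun a =>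
    ⟨parts a.1, fun {i} hi => by
      obtain ⟨k, -, hk⟩ := Multiset.mem_sum.1 hi
      rw [Multiset.eq_of_mem_replicate hk]
      exact Nat.succ_pos _, (hsum a.1).trans ((mem_weightVectors hm).1 a.2)⟩
  have hP : Function.Injective P := fun a b h => by
    have h1 : parts a.1 = parts b.1 := congrArg Nat.Partition.parts h
    refine Subtype.ext (funext fun k => ?_)
    rw [← hcount a.1 k, h1, hcount]
  simpa using Fintype.card_le_of_injective P hP

/-- This is the coefficient bound for Euler's product generating function, all of whose terms are
nonnegative. -/
theorem card_weightVectors_mul_pow_le {n m : ℕ} (hm : m ≤ n) {x : ℝ} (hx : 0 < x) (hx1 : x < 1) :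
    (weightVectors n m).card * x ^ m ≤ ∏ k : Fin n, (1 - x ^ ((k : ℕ) + 1))⁻¹ := by
  calc (weightVectors n m).card * x ^ m
      = ∑ a ∈ weightVectors n m, ∏ k : Fin n, x ^ (((k : ℕ) + 1) * a k) := by
        rw [← nsmul_eq_mul, ← Finset.sum_const]
        refine Finset.sum_congr rfl fun a ha => ?_
        rw [Finset.prod_pow_eq_pow_sum, ← (mem_weightVectors hm).1 ha]
        simp only [mul_comm]
    _ ≤ ∑ a ∈ Fintype.piFinset fun _ : Fin n => Finset.range (n + 1),
          ∏ k : Fin n, x ^ (((k : ℕ) + 1) * a k) :=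
        Finset.sum_le_sum_of_subset_of_nonneg (Finset.filter_subset _ _)
          fun _ _ _ => Finset.prod_nonneg fun _ _ => by positivity
    _ = ∏ k : Fin n, ∑ j ∈ Finset.range (n + 1), x ^ (((k : ℕ) + 1) * j) :=
        (Finset.prod_univ_sum (fun _ => Finset.range (n + 1))
          (fun (k : Fin n) j => x ^ (((k : ℕ) + 1) * j))).symm
    _ ≤ _ := by
        refine Finset.prod_le_prod (fun _ _ => Finset.sum_nonneg fun _ _ => by positivity)
          fun k _ => ?_
        simp only [pow_mul]
        have h1 : x ^ ((k : ℕ) + 1) < 1 := pow_lt_one₀ hx.le hx1 (Nat.succ_ne_zero _)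
        rw [← tsum_geometric_of_lt_one (by positivity) h1]
        exact (summable_geometric_of_lt_one (by positivity) h1).sum_le_tsum _
          fun _ _ => by positivity

/-- Expand the logarithms as power series and sum over `k` first: with `x = exp (-t)`, `exp (jt) ≥ 1
+ jt` gives `x^j / (1 - x^j) ≤ 1 / (jt)`, and `∑ 1 / j^2 = π^2 / 6`. -/
theorem prod_one_sub_exp_inv_le (n : ℕ) {t : ℝ} (ht : 0 < t) :
    ∏ k : Fin n, (1 - Real.exp (-t) ^ ((k : ℕ) + 1))⁻¹ ≤ Real.exp (Real.pi ^ 2 / 6 / t) := by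
  set x := Real.exp (-t) with hx
  have hx0 : 0 < x := Real.exp_pos _
  have hx1 : x < 1 := Real.exp_lt_one_iff.2 (by linarith)
  have hlt : ∀ k : ℕ, x ^ (k + 1) < 1 := fun k => pow_lt_one₀ hx0.le hx1 (Nat.succ_ne_zero _)
  have hpos : ∀ k : ℕ, 0 < 1 - x ^ (k + 1) := fun k => sub_pos.2 (hlt k)
  rw [← Real.log_le_iff_le_exp (Finset.prod_pos fun (k : Fin n) _ => inv_pos.2 (hpos k)),
    Real.log_prod (fun (k : Fin n) _ => (inv_pos.2 (hpos k)).ne')]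
  have hlog : ∀ k : ℕ, HasSum (fun j : ℕ => (x ^ (k + 1)) ^ (j + 1) / ((j : ℝ) + 1))
      (Real.log (1 - x ^ (k + 1))⁻¹) := fun k => by
    rw [Real.log_inv]
    exact Real.hasSum_pow_div_log_of_abs_lt_one
      (by rw [abs_of_pos (by positivity)]; exact hlt k)
  have hsum := hasSum_sum (s := (Finset.univ : Finset (Fin n))) fun k _ => hlog (k : ℕ)
  have hzeta : HasSum (fun j : ℕ => 1 / ((j : ℝ) + 1) ^ 2 / t) (Real.pi ^ 2 / 6 / t) := by
    have := (hasSum_nat_add_iff' 1).2 hasSum_zeta_two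
    simpa using this.div_const t
  refine hasSum_le (fun j => ?_) hsum hzeta
  have hy : ∀ k : Fin n, (x ^ ((k : ℕ) + 1)) ^ (j + 1) = x ^ (j + 1) * (x ^ (j + 1)) ^ (k : ℕ) := by
    intro k
    ring
  rw [← Finset.sum_div, Finset.sum_congr rfl fun k _ => hy k, ← Finset.mul_sum,
    Fin.sum_univ_eq_sum_range (fun k => (x ^ (j + 1)) ^ k) n]
  have h1 : ∑ k ∈ Finset.range n, (x ^ (j + 1)) ^ k ≤ (1 - x ^ (j + 1))⁻¹ := by
    rw [← tsum_geometric_of_lt_one (by positivity) (hlt j)]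
    exact (summable_geometric_of_lt_one (by positivity) (hlt j)).sum_le_tsum _
      fun _ _ => by positivity
  have h2 : x ^ (j + 1) * (1 - x ^ (j + 1))⁻¹ ≤ 1 / (((j : ℝ) + 1) * t) := by
    rw [← div_eq_mul_inv, div_le_div_iff₀ (hpos j) (by positivity), one_mul]
    have h3 : x ^ (j + 1) * Real.exp (((j : ℝ) + 1) * t) = 1 := by
      rw [hx, ← Real.exp_nat_mul, ← Real.exp_add, Real.exp_eq_one_iff]
      push_cast
      ring
    have h4 := Real.add_one_le_exp (((j : ℝ) + 1) * t)
    have h5 := mul_le_mul_of_nonneg_left h4 (pow_pos hx0 (j + 1)).le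
    rw [h3] at h5
    linarith
  calc x ^ (j + 1) * (∑ k ∈ Finset.range n, (x ^ (j + 1)) ^ k) / ((j : ℝ) + 1)
      ≤ 1 / (((j : ℝ) + 1) * t) / ((j : ℝ) + 1) := by
        gcongr
        exact (mul_le_mul_of_nonneg_left h1 (by positivity)).trans h2
    _ = 1 / ((j : ℝ) + 1) ^ 2 / t := by
        field_simp

theorem two_mul_card_weightVectors_le {n m : ℕ} (hn : 0 < n) (hm : m ≤ n) :
    (2 : ℝ) * (weightVectors n m).card ≤ 2 ^ (4 * Real.sqrt (n : ℝ)) := by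
  have hs : Real.sqrt n * Real.sqrt n = n := Real.mul_self_sqrt (Nat.cast_nonneg n)
  -- For `n ≤ 16` one has `n ≤ 4√n`, so the composition bound suffices.
  rcases le_total n 16 with h16 | h16
  · have h1 : 2 * (weightVectors n m).card ≤ 2 ^ n := by
      have := card_weightVectors_le_two_pow hm
      calc 2 * (weightVectors n m).card ≤ 2 * 2 ^ (m - 1) := by omega
        _ = 2 ^ (m - 1 + 1) := by ring
        _ ≤ 2 ^ n := Nat.pow_le_pow_right two_pos (by omega)
    have h2 : (2 : ℝ) * (weightVectors n m).card ≤ 2 ^ (n : ℝ) := by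
      rw [Real.rpow_natCast]
      exact_mod_cast h1
    refine h2.trans (Real.rpow_le_rpow_of_exponent_le one_le_two ?_)
    have h4 : Real.sqrt n ≤ 4 := by
      rw [Real.sqrt_le_left (by norm_num)]
      norm_num
      exact_mod_cast h16
    nlinarith [Real.sqrt_nonneg (n : ℝ)]
  · have h4 : 4 ≤ Real.sqrt n := by
      rw [Real.le_sqrt' (by norm_num)]
      norm_num
      exact_mod_cast h16
    have hl := Real.log_two_gt_d9
    have hl0 : 0 < Real.log 2 := by linarith
    set s := Real.sqrt n with hsdef
    have hs0 : 0 < s := by linarith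
    -- With this `t` the exponents are `t n = 2 log 2 · s` and at most `7/4 log 2 · s`. The
    -- remaining `log 2 · s / 4` pays for the factor 2, as `s ≥ 4`.
    set t := 2 * Real.log 2 / s with ht
    have ht0 : 0 < t := by positivity
    have h1 := (card_weightVectors_mul_pow_le hm (Real.exp_pos (-t))
      (Real.exp_lt_one_iff.2 (by linarith))).trans (prod_one_sub_exp_inv_le n ht0)
    have hts : t * n = 2 * Real.log 2 * s := by
      rw [← hs, ht]
      field_simp
    have hpi : Real.pi ^ 2 / 6 / t ≤ 7 / 4 * Real.log 2 * s := by
      rw [ht, div_div_eq_mul_div, div_le_iff₀ (by positivity)]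
      have hpi2 : Real.pi ^ 2 / 6 ≤ 7 / 2 * Real.log 2 ^ 2 := by
        have := Real.pi_lt_d4
        have := Real.pi_pos
        nlinarith
      nlinarith
    have h2 : ((weightVectors n m).card : ℝ) ≤
        Real.exp (Real.pi ^ 2 / 6 / t) * Real.exp (t * n) := by
      have h3 : Real.exp (-t) ^ m * Real.exp (t * m) = 1 := by
        rw [← Real.exp_nat_mul, ← Real.exp_add, Real.exp_eq_one_iff]
        ring
      calc ((weightVectors n m).card : ℝ)
          = (weightVectors n m).card * Real.exp (-t) ^ m * Real.exp (t * m) := by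
            rw [mul_assoc, h3, mul_one]
        _ ≤ Real.exp (Real.pi ^ 2 / 6 / t) * Real.exp (t * n) := by gcongr
    calc (2 : ℝ) * (weightVectors n m).card
        ≤ Real.exp (Real.log 2) * (Real.exp (Real.pi ^ 2 / 6 / t) * Real.exp (t * n)) := by
          rw [Real.exp_log two_pos]
          gcongr
      _ = Real.exp (Real.log 2 + (Real.pi ^ 2 / 6 / t + t * n)) := by
          rw [Real.exp_add, Real.exp_add]
      _ ≤ Real.exp (Real.log 2 * (4 * s)) := by
          refine Real.exp_le_exp.2 ?_
          rw [hts]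
          nlinarith
      _ = 2 ^ (4 * s) := (Real.rpow_def_of_pos two_pos _).symm

/-! ### Assembling both bounds -/

theorem theorem1 (q : ℕ) (hq : IsPrimePow q) (F : Type*) [Field F] [Finite F]
    (hF : Nat.card F = q) (n : ℕ) (hn : 0 < n) :
    (∑ lam ∈ boundedWeightVectors n, ∏ k : Fin n,
        (numModuliOfOrder q ((k : ℕ) + 1) + lam k - 1).choose (lam k)) ≤
      numFunctionalGraphs F n ∧
    (numFunctionalGraphs F n : ℝ) ≤
      (2 : ℝ) ^ (4 * Real.sqrt (n : ℝ)) *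
        ((∑ lam ∈ boundedWeightVectors n, ∏ k : Fin n,
          (numDivisors q ((k : ℕ) + 1) + lam k - 1).choose (lam k) : ℕ) : ℝ) := by
  subst hF
  refine ⟨le_numFunctionalGraphs n, ?_⟩
  set C : (Fin n → ℕ) → ℕ := fun lam => ∏ k : Fin n,
    (numDivisors (Nat.card F) ((k : ℕ) + 1) + lam k - 1).choose (lam k) with hC
  set B : ℝ := (2 : ℝ) ^ (4 * Real.sqrt (n : ℝ)) with hB
  have hC0 : C 0 = 1 := by simp [hC]
  -- With `S` this sum, the upper bound is `B/2 + B/2 · S`, where the first term comes from `λ = 0`;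
  -- `S ≥ 1` makes it at most `B · S`.
  have hpos : 1 ≤ ∑ lam ∈ boundedWeightVectors n, C lam := by
    let lam₁ : Fin n → ℕ := Pi.single ⟨0, hn⟩ 1
    have hmem : lam₁ ∈ boundedWeightVectors n := by
      refine mem_boundedWeightVectors.2 ⟨by simp [lam₁], ?_⟩
      rw [Finset.sum_eq_single ⟨0, hn⟩ (fun k _ hk => by simp [lam₁, hk]) (by simp)]
      simpa [lam₁] using Nat.one_le_iff_ne_zero.2 hn.ne'
    refine le_trans ?_ (Finset.single_le_sum (fun _ _ => Nat.zero_le _) hmem)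
    refine Nat.one_le_iff_ne_zero.2 (Finset.prod_ne_zero_iff.2 fun k _ => ?_)
    have hdiv : 0 < numDivisors (Nat.card F) ((k : ℕ) + 1) := by
      refine Finset.card_pos.2 (Nat.nonempty_divisors.2 ?_)
      exact (Nat.sub_pos_of_lt (Nat.one_lt_pow (Nat.succ_ne_zero _) Finite.one_lt_card)).ne'
    exact (Nat.choose_pos (by omega)).ne'
  have h0 : (0 : Fin n → ℕ) ∉ boundedWeightVectors n := fun h =>
    (mem_boundedWeightVectors.1 h).1 rfl
  have hle : (numFunctionalGraphs F n : ℝ) ≤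
      ∑ lam ∈ insert 0 (boundedWeightVectors n), B / 2 * C lam := by
    refine (Nat.cast_le.2 (numFunctionalGraphs_le (F := F) n)).trans ?_
    rw [Nat.cast_sum]
    refine Finset.sum_le_sum fun lam _ => ?_
    rw [Nat.cast_mul]
    refine mul_le_mul_of_nonneg_right ?_ (Nat.cast_nonneg _)
    have := two_mul_card_weightVectors_le hn (Nat.sub_le n (∑ k, lam k * ((k : ℕ) + 1)))
    linarith
  rw [Finset.sum_insert h0, ← Finset.mul_sum, ← Nat.cast_sum, hC0] at hle
  have hB0 : 0 ≤ B := by positivity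
  have h1 : (1 : ℝ) ≤ ((∑ lam ∈ boundedWeightVectors n, C lam : ℕ) : ℝ) := by exact_mod_cast hpos
  push_cast at hle h1 ⊢
  nlinarith
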